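/- Let $\mathcal A$ be a (not necessarily unital) $C^*$-algebra with positive cone $\mathcal A_+$ and the order $a\le b \iff b-a\in\mathcal A_+$. Let $\mathcal X$ be a set and let $k:\mathcal X\times\mathcal X\to\mathcal A$ be a positive definite kernel, i.e. $k(x,y)=k(y,x)^*$ and $\sum_{i,j=1}^n c_i^*k(x_i,x_j)c_j\in\mathcal A_+$ for all $n\in\mathbb N$, $c_i\in\mathcal A$, $x_i\in\mathcal X$. Put $\phi(x)=k(\cdot,x):\mathcal X\to\mathcal A$, and let $\mathcal M_{k,0}$ be the space of the functions $\sum_{i=1}^n\phi(x_i)c_i$ with the $\mathcal A$-valued inner product $$\Big\langle\sum_i\phi(x_i)c_i,\sum_j\phi(y_j)d_j\Big\rangle_k=\sum_{i,j}c_i^*k(x_i,y_j)d_j$$ and the norm $\|f\|_k=\|\langle f,f\rangle_k\|_{\mathcal A}^{1/2}$. Let the reproducing kernel Hilbert $\mathcal A$-module (RKHM) $\mathcal M_k$ be the completion of $\mathcal M_{k,0}$; the inner product and the evaluations $f\mapsto f(x)$ extend to $\mathcal M_k$ by continuity, and $|f|_k=\langle f,f\rangle_k^{1/2}\in\mathcal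 A_+$ for $f\in\mathcal M_k$. Let $x_1,\dots,x_N\in\mathcal X$, let $g:\mathcal A^N\to\mathcal A_+$ be continuous, and let $h:\mathcal A_+\to\mathcal A_+$ satisfy $h(c)\le h(d)$ whenever $c,d\in\mathcal A_+$ and $c\le d$. For $f\in\mathcal M_k$ let $$L(f)=g(f(x_1),\dots,f(x_N))+h(|f|_k).$$ If $f_0\in\mathcal M_k$ is a minimizer of $L$, i.e. $L(f_0)\le L(f)$ for all $f\in\mathcal M_k$, then for every $\epsilon>0$ there are $c_1,\dots,c_N\in\mathcal A$ such that $\tilde f=\sum_{i=1}^N\phi(x_i)c_i$ satisfies $\|L(\tilde f)-L(f_0)\|_{\mathcal A}\le\epsilon$. -/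

import Mathlib

noncomputable section

open scoped RightActions

/-- An `A`-valued positive definite kernel on a set `X`, for a C⋆-algebra `A`. -/
structure PDKernel (X A : Type*) [NonUnitalCStarAlgebra A] [PartialOrder A] where
  toFun : X → X → A
  star_symm : ∀ x y, toFun x y = star (toFun y x)
  nonneg : ∀ (n : ℕ) (x : Fin n → X) (c : Fin n → A),
    0 ≤ ∑ i, ∑ j, star (c i) * toFun (x i) (x j) * c j

namespace PDKernel

variable {X A : Type*} [NonUnitalCStarAlgebra A] [PartialOrder A]

/-- The feature map `φ(x) = k(·, x)`, with values in the functions `X → A`. Functions `X → A` are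
multiplied by elements of `A` on the right, pointwise: `(f <• c) y = f y * c`. -/
def feature (k : PDKernel X A) (x : X) : X → A := fun y => k.toFun y x

/-- The finite sum `∑ i, φ(x i) c i`, as a function `X → A`. -/
def comb (k : PDKernel X A) {n : ℕ} (x : Fin n → X) (c : Fin n → A) : X → A :=
  ∑ i, k.feature (x i) <• c i

lemma comb_apply (k : PDKernel X A) {n : ℕ} (x : Fin n → X) (c : Fin n → A) (y : X) :
    k.comb x c y = ∑ i, k.toFun y (x i) * c i := by
  simp [comb, feature]

/-- The space `M_{k,0}` of all finite sums `∑ i, φ(x i) c i`. -/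
def preSubmodule (k : PDKernel X A) : Submodule ℂ (X → A) where
  carrier := {f | ∃ (n : ℕ) (x : Fin n → X) (c : Fin n → A), f = k.comb x c}
  zero_mem' := ⟨0, Fin.elim0, Fin.elim0, by simp [comb]⟩
  add_mem' := by
    rintro _ _ ⟨n, x, c, rfl⟩ ⟨m, y, d, rfl⟩
    refine ⟨n + m, Fin.append x y, Fin.append c d, ?_⟩
    simp [comb, Fin.sum_univ_add]
  smul_mem' := by
    rintro z _ ⟨n, x, c, rfl⟩
    refine ⟨n, x, fun i => z • c i, ?_⟩
    ext y
    simp [comb_apply, Finset.smul_sum, mul_smul_comm]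

/-- `M_{k,0}` as a type of its own, so that it does not inherit the topology of `X → A`. -/
def Pre (k : PDKernel X A) : Type _ := k.preSubmodule

instance (k : PDKernel X A) : AddCommGroup k.Pre := inferInstanceAs (AddCommGroup k.preSubmodule)

instance (k : PDKernel X A) : Module ℂ k.Pre := inferInstanceAs (Module ℂ k.preSubmodule)

/-- Evaluation on `M_{k,0}`, whose elements are functions on `X`. -/
def preEval (k : PDKernel X A) (x : X) : k.Pre →ₗ[ℂ] A :=
  (LinearMap.proj x).comp k.preSubmodule.subtype

lemma pre_ext {k : PDKernel X A} {f g : k.Pre} (h : ∀ x, k.preEval x f = k.preEval x g) : f = g :=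
  Subtype.ext (funext h)

lemma pre_exists_rep {k : PDKernel X A} (f : k.Pre) :
    ∃ (n : ℕ) (x : Fin n → X) (c : Fin n → A), ∀ y, k.preEval y f = k.comb x c y := by
  obtain ⟨n, x, c, h⟩ := f.2
  exact ⟨n, x, c, fun y => congrFun h y⟩

/-- The right action of `A` on `M_{k,0}`. -/
instance (k : PDKernel X A) : SMul Aᵐᵒᵖ k.Pre where
  smul a f := ⟨f.1 <• a.unop, by
    obtain ⟨n, x, c, h⟩ := f.2
    refine ⟨n, x, fun i => c i * a.unop, ?_⟩
    ext y
    simp [h, comb_apply, Finset.sum_mul, mul_assoc]⟩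

@[simp]
lemma preEval_op_smul {k : PDKernel X A} (x : X) (a : A) (f : k.Pre) :
    k.preEval x (f <• a) = k.preEval x f * a := rfl

/-- The element `φ(x) c` of `M_{k,0}`. -/
def preFeatureMul (k : PDKernel X A) (x : X) (c : A) : k.Pre :=
  ⟨k.feature x <• c, 1, fun _ => x, fun _ => c, by simp [comb]⟩

@[simp]
lemma preEval_preFeatureMul (k : PDKernel X A) (x y : X) (c : A) :
    k.preEval y (k.preFeatureMul x c) = k.toFun y x * c := rfl

/-- The `A`-valued inner product on `M_{k,0}`: if `f = ∑ i, φ(x i) c i` and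
`g = ∑ j, φ(y j) d j`, it is `∑ i, (c i)⋆ g(x i) = ∑ i, ∑ j, (c i)⋆ k(x i, y j) d j`. It does not
depend on the representations chosen, see `preInner_eq` and `preInner_eq_sum`. -/
def preInner (k : PDKernel X A) (f g : k.Pre) : A :=
  ∑ i, star ((pre_exists_rep f).choose_spec.choose_spec.choose i) *
    k.preEval ((pre_exists_rep f).choose_spec.choose i) g

lemma star_preEval_sum {k : PDKernel X A} {f g : k.Pre} {n m : ℕ} {x : Fin n → X}
    {c : Fin n → A} {y : Fin m → X} {d : Fin m → A} (hf : ∀ z, k.preEval z f = k.comb x c z)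
    (hg : ∀ z, k.preEval z g = k.comb y d z) :
    ∑ i, star (c i) * k.preEval (x i) g = ∑ j, star (k.preEval (y j) f) * d j := by
  simp only [hf, hg, comb_apply, Finset.mul_sum, star_sum, star_mul, Finset.sum_mul]
  rw [Finset.sum_comm]
  refine Finset.sum_congr rfl fun j _ => Finset.sum_congr rfl fun i _ => ?_
  rw [← k.star_symm, mul_assoc]

lemma preInner_eq {k : PDKernel X A} {f : k.Pre} (g : k.Pre) {n : ℕ} {x : Fin n → X}
    {c : Fin n → A} (hf : ∀ z, k.preEval z f = k.comb x c z) :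
    k.preInner f g = ∑ i, star (c i) * k.preEval (x i) g := by
  obtain ⟨m, y, d, hg⟩ := pre_exists_rep g
  rw [preInner, star_preEval_sum (pre_exists_rep f).choose_spec.choose_spec.choose_spec hg,
    star_preEval_sum hf hg]

lemma preInner_eq_sum {k : PDKernel X A} {f g : k.Pre} {n m : ℕ} {x : Fin n → X}
    {c : Fin n → A} {y : Fin m → X} {d : Fin m → A} (hf : ∀ z, k.preEval z f = k.comb x c z)
    (hg : ∀ z, k.preEval z g = k.comb y d z) :
    k.preInner f g = ∑ i, ∑ j, star (c i) * k.toFun (x i) (y j) * d j := by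
  simp only [preInner_eq g hf, hg, comb_apply, Finset.mul_sum, mul_assoc]

/-- The reproducing property on `M_{k,0}`. -/
lemma preInner_preFeatureMul (k : PDKernel X A) (x : X) (c : A) (f : k.Pre) :
    k.preInner (k.preFeatureMul x c) f = star c * k.preEval x f := by
  rw [preInner_eq (n := 1) (x := fun _ => x) (c := fun _ => c) f
    (by intro z; simp [comb_apply])]
  simp

lemma preInner_add_right {k : PDKernel X A} (f g h : k.Pre) :
    k.preInner f (g + h) = k.preInner f g + k.preInner f h := by
  simp [preInner, mul_add, Finset.sum_add_distrib]

lemma preInner_smul_right {k : PDKernel X A} (z : ℂ) (f g : k.Pre) :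
    k.preInner f (z • g) = z • k.preInner f g := by
  simp [preInner, Finset.smul_sum, mul_smul_comm]

lemma preInner_op_smul_right {k : PDKernel X A} (a : A) (f g : k.Pre) :
    k.preInner f (g <• a) = k.preInner f g * a := by
  simp [preInner, Finset.sum_mul, mul_assoc]

lemma star_preInner {k : PDKernel X A} (f g : k.Pre) :
    star (k.preInner f g) = k.preInner g f := by
  obtain ⟨n, x, c, hf⟩ := pre_exists_rep f
  obtain ⟨m, y, d, hg⟩ := pre_exists_rep g
  rw [preInner_eq g hf, preInner_eq f hg, star_preEval_sum hf hg]
  simp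

lemma preInner_self_nonneg {k : PDKernel X A} (f : k.Pre) : 0 ≤ k.preInner f f := by
  obtain ⟨n, x, c, hf⟩ := pre_exists_rep f
  rw [preInner_eq_sum hf hf]
  exact k.nonneg n x c

lemma preInner_add_left {k : PDKernel X A} (f g h : k.Pre) :
    k.preInner (f + g) h = k.preInner f h + k.preInner g h := by
  rw [← star_preInner, preInner_add_right, star_add, star_preInner, star_preInner]

lemma preInner_op_smul_left {k : PDKernel X A} (a : A) (f g : k.Pre) :
    k.preInner (f <• a) g = star a * k.preInner f g := by
  rw [← star_preInner, preInner_op_smul_right, star_mul, star_preInner]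

lemma preInner_smul_left {k : PDKernel X A} (z : ℂ) (f g : k.Pre) :
    k.preInner (z • f) g = star z • k.preInner f g := by
  rw [← star_preInner, preInner_smul_right, star_smul, star_preInner]

/-- The norm `‖f‖ = ‖⟨f, f⟩‖ ^ (1/2)` on `M_{k,0}`. -/
instance (k : PDKernel X A) : Norm k.Pre where
  norm f := √‖k.preInner f f‖

lemma pre_norm_def {k : PDKernel X A} (f : k.Pre) : ‖f‖ = √‖k.preInner f f‖ := rfl

variable [StarOrderedRing A]

lemma preInner_eq_zero_of_self {k : PDKernel X A} {f : k.Pre} (hf : k.preInner f f = 0)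
    (g : k.Pre) : k.preInner f g = 0 := by
  set b := k.preInner f g with hb
  have key : ∀ t : ℝ, 0 < t → t * ‖star b * b‖ ≤ ‖k.preInner g g‖ := by
    intro t ht
    have h0 := preInner_self_nonneg (g + (-((t / 2 : ℝ) : ℂ)) • (f <• b))
    have hgf : k.preInner g f = star b := by rw [hb, star_preInner]
    simp only [preInner_add_left, preInner_add_right, preInner_smul_left, preInner_smul_right,
      preInner_op_smul_left, preInner_op_smul_right, hf, hgf, ← hb, mul_zero, smul_zero,
      add_zero] at h0
    have h1 : t • (star b * b) ≤ k.preInner g g := by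
      rw [← sub_nonneg]
      convert h0 using 1
      have : t • (star b * b) = ((t : ℝ) : ℂ) • (star b * b) := by simp
      rw [this]
      simp only [star_neg, Complex.star_def, Complex.conj_ofReal, add_assoc, ← add_smul,
        sub_eq_add_neg, ← neg_smul]
      congr 2
      push_cast
      ring
    have h2 : 0 ≤ t • (star b * b) := smul_nonneg ht.le (star_mul_self_nonneg b)
    have h3 := CStarAlgebra.norm_le_norm_of_nonneg_of_le h2 h1
    rwa [norm_smul, Real.norm_of_nonneg ht.le] at h3
  have hz : ‖star b * b‖ = 0 := by
    by_contra hne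
    have hpos : 0 < ‖star b * b‖ := lt_of_le_of_ne (norm_nonneg _) (Ne.symm hne)
    have h4 := key ((‖k.preInner g g‖ + 1) / ‖star b * b‖) (by positivity)
    rw [div_mul_cancel₀ _ hne] at h4
    linarith
  rwa [CStarRing.norm_star_mul_self, mul_self_eq_zero, norm_eq_zero] at hz

lemma preInner_self_eq_zero {k : PDKernel X A} {f : k.Pre} : k.preInner f f = 0 ↔ f = 0 := by
  refine ⟨fun hf => pre_ext fun x => ?_, ?_⟩
  · have h := preInner_eq_zero_of_self hf (k.preFeatureMul x (k.preEval x f))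
    rw [← star_preInner, preInner_preFeatureMul, star_eq_zero, ← norm_eq_zero,
      CStarRing.norm_star_mul_self, mul_self_eq_zero, norm_eq_zero] at h
    rw [h, map_zero]
  · rintro rfl
    simp [preInner]

/-- Right Hilbert modules over `A` are Mathlib's Hilbert C⋆-modules over the opposite algebra. -/
instance (k : PDKernel X A) : CStarModule Aᵐᵒᵖ k.Pre where
  inner f g := MulOpposite.op (k.preInner f g)
  inner_add_right := by intros; simp [preInner_add_right]
  inner_self_nonneg := by intro f; exact preInner_self_nonneg f
  inner_self := by intro f; simp [preInner_self_eq_zero]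
  inner_op_smul_right := by
    intro a f g
    exact congrArg MulOpposite.op (preInner_op_smul_right a.unop f g)
  inner_smul_right_complex := by intros; simp [preInner_smul_right]
  star_inner f g := by simp [← MulOpposite.op_star, star_preInner]
  norm_eq_sqrt_norm_inner_self f := rfl

instance (k : PDKernel X A) : NormedAddCommGroup k.Pre :=
  NormedAddCommGroup.ofCore (CStarModule.normedSpaceCore Aᵐᵒᵖ)

instance (k : PDKernel X A) : NormedSpace ℂ k.Pre :=
  NormedSpace.ofCore (CStarModule.normedSpaceCore Aᵐᵒᵖ)

lemma norm_preInner_le {k : PDKernel X A} (f g : k.Pre) : ‖k.preInner f g‖ ≤ ‖f‖ * ‖g‖ :=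
  CStarModule.norm_inner_le (A := Aᵐᵒᵖ) k.Pre (x := f) (y := g)

lemma continuous_preInner (k : PDKernel X A) :
    Continuous fun p : k.Pre × k.Pre => k.preInner p.1 p.2 :=
  MulOpposite.continuous_unop.comp (CStarModule.continuous_inner (A := Aᵐᵒᵖ) (E := k.Pre))

lemma norm_preEval_le (k : PDKernel X A) (x : X) (f : k.Pre) :
    ‖k.preEval x f‖ ≤ √‖k.toFun x x‖ * ‖f‖ := by
  rcases eq_or_ne (k.preEval x f) 0 with h0 | h0
  · rw [h0, norm_zero]; positivity
  set d := k.preEval x f with hd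
  have hpos : 0 < ‖d‖ := norm_pos_iff.mpr h0
  have h1 := norm_preInner_le (k.preFeatureMul x d) f
  rw [preInner_preFeatureMul, ← hd, CStarRing.norm_star_mul_self] at h1
  have h2 : ‖k.preFeatureMul x d‖ ≤ √‖k.toFun x x‖ * ‖d‖ := by
    rw [pre_norm_def, preInner_preFeatureMul, preEval_preFeatureMul]
    refine Real.sqrt_le_iff.mpr ⟨by positivity, ?_⟩
    rw [mul_pow, Real.sq_sqrt (norm_nonneg _)]
    calc ‖star d * (k.toFun x x * d)‖ ≤ ‖star d‖ * (‖k.toFun x x‖ * ‖d‖) :=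
          (norm_mul_le _ _).trans (by gcongr; exact norm_mul_le _ _)
      _ = ‖k.toFun x x‖ * ‖d‖ ^ 2 := by rw [norm_star]; ring
  have h3 : ‖d‖ * ‖d‖ ≤ ‖d‖ * (√‖k.toFun x x‖ * ‖f‖) := by
    calc _ ≤ _ := h1
      _ ≤ (√‖k.toFun x x‖ * ‖d‖) * ‖f‖ := by gcongr
      _ = _ := by ring
  exact le_of_mul_le_mul_left h3 hpos

/-- The reproducing kernel Hilbert module `M_k`: the completion of `M_{k,0}`. -/
abbrev RKHM (k : PDKernel X A) : Type _ := UniformSpace.Completion k.Pre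

/-- The value `f(x)` of an element `f` of `M_k`: the extension by continuity of the evaluation of
functions in `M_{k,0}`. -/
def eval (k : PDKernel X A) (x : X) : k.RKHM →L[ℂ] A :=
  ((k.preEval x).mkContinuous (√‖k.toFun x x‖) (k.norm_preEval_le x)).extend
    UniformSpace.Completion.toComplL

/-- The `A`-valued inner product on `M_k`: the extension by continuity of that of `M_{k,0}`. -/
def inner (k : PDKernel X A) (f g : k.RKHM) : A :=
  (UniformSpace.Completion.isDenseInducing_coe.prodMap
    UniformSpace.Completion.isDenseInducing_coe).extend
    (fun p : k.Pre × k.Pre => k.preInner p.1 p.2) (f, g)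

lemma eval_coe (k : PDKernel X A) (x : X) (f : k.Pre) :
    k.eval x (f : k.RKHM) = k.preEval x f :=
  ContinuousLinearMap.extend_eq _ UniformSpace.Completion.denseRange_coe
    (UniformSpace.Completion.isUniformInducing_coe _) f

lemma inner_coe (k : PDKernel X A) (f g : k.Pre) :
    k.inner (f : k.RKHM) (g : k.RKHM) = k.preInner f g :=
  (UniformSpace.Completion.isDenseInducing_coe.prodMap
    UniformSpace.Completion.isDenseInducing_coe).extend_eq k.continuous_preInner (f, g)

lemma continuous_inner (k : PDKernel X A) :
    Continuous fun p : k.RKHM × k.RKHM => k.inner p.1 p.2 := by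
  let B : k.Pre →+ k.Pre →+ A :=
    AddMonoidHom.mk' (fun f => AddMonoidHom.mk' (fun g => k.preInner f g) (preInner_add_right f))
      fun f g => by ext h; exact preInner_add_left f g h
  have hB : Continuous fun p : k.Pre × k.Pre => B p.1 p.2 := k.continuous_preInner
  have h : IsDenseInducing (UniformSpace.Completion.toCompl : k.Pre →+ k.RKHM) :=
    UniformSpace.Completion.isDenseInducing_coe
  have hE : Continuous ((h.prodMap h).extend fun p : k.Pre × k.Pre => B p.1 p.2) :=
    h.extend_Z_bilin h hB
  exact hE

/-- The `A`-valued absolute value `|f|_k = ⟨f, f⟩ ^ (1/2)`, an element of the positive cone. -/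
def absVal (k : PDKernel X A) (f : k.RKHM) : {a : A // 0 ≤ a} :=
  ⟨CFC.sqrt (k.inner f f), CFC.sqrt_nonneg _⟩

/-- The element `φ(x) c` of `M_k`. -/
def featureMul (k : PDKernel X A) (x : X) (c : A) : k.RKHM := (k.preFeatureMul x c : k.RKHM)

/-- The loss `L(f) = g(f(x₁), …, f(x_N)) + h(|f|_k)`. -/
def loss (k : PDKernel X A) {N : ℕ} (x : Fin N → X) (g : (Fin N → A) → {a : A // 0 ≤ a})
    (h : {a : A // 0 ≤ a} → {a : A // 0 ≤ a}) (f : k.RKHM) : A :=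
  (g fun i => k.eval (x i) f) + h (k.absVal f)

end PDKernel

end

/-!
Let `T` evaluate at the points `x₁, …, x_N`; its adjoint sends `c` to `∑ i, φ(x i) c i`. Closed
submodules of Hilbert modules need not be complemented, so `f₀` cannot be projected onto the range
of `T⋆`. The Landweber iterates `fₙ = f₀ - (1 - τ T⋆T)ⁿ f₀` replace the projection: they lie in the
range of `T⋆`, and for small `τ > 0` the operator `B = 1 - τ T⋆T` is a positive contraction, so the
moments `aₘ = ⟨f₀, Bᵐ f₀⟩` form a nonnegative, decreasing, convex sequence in `A`. Hence
`⟨fₙ, fₙ⟩ = a₀ - 2 aₙ + a₂ₙ ≤ ⟨f₀, f₀⟩`, so that `h` does not increase, while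
`n (aₙ - aₙ₊₁) ≤ a₀` forces `τ |T Bⁿ f₀|² = a₂ₙ - a₂ₙ₊₁` to tend to `0`, so that the values of `fₙ`
at the points `x i` converge to those of `f₀`.
-/

section PositiveContraction

variable {E A : Type*} [AddCommGroup E]

lemma sub_iterate_mem {B : E → E} {K : AddSubgroup E} (hB : ∀ f, f - B f ∈ K) (f : E) (n : ℕ) :
    f - B^[n] f ∈ K := by
  induction n with
  | zero => simp
  | succ n ih =>
    rw [Function.iterate_succ_apply', ← sub_add_sub_cancel f (B^[n] f)]
    exact add_mem ih (hB _)

variable [AddCommGroup A] {p : E →+ E →+ A} {B : E →+ E}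

lemma apply_iterate_iterate (hB : ∀ f g, p (B f) g = p f (B g)) (f g : E) (i j : ℕ) :
    p (B^[i] f) (B^[j] g) = p f (B^[i + j] g) := by
  induction i generalizing j with
  | zero => simp
  | succ i ih =>
    rw [Function.iterate_succ_apply', hB, ← Function.iterate_succ_apply' B, ih, add_right_comm,
      add_assoc]

/-- `B` is a positive contraction for the `A`-valued form `p`: it is symmetric and
`0 ≤ p f (B f) ≤ p f f`. In particular `p` is positive semidefinite. -/
structure IsPositiveContraction [PartialOrder A] (p : E →+ E →+ A) (B : E →+ E) : Prop where
  symmetric : ∀ f g, p (B f) g = p f (B g)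
  nonneg : ∀ f, 0 ≤ p f (B f)
  apply_le : ∀ f, p f (B f) ≤ p f f

namespace IsPositiveContraction

variable [PartialOrder A]

lemma apply_iterate_nonneg (hB : IsPositiveContraction p B) (f : E) (m : ℕ) :
    0 ≤ p f (B^[m] f) := by
  obtain ⟨j, rfl | rfl⟩ := m.even_or_odd'
  · rw [two_mul, ← apply_iterate_iterate hB.symmetric]
    exact (hB.nonneg _).trans (hB.apply_le _)
  · rw [two_mul, add_assoc, ← apply_iterate_iterate hB.symmetric, Function.iterate_succ_apply']
    exact hB.nonneg _

variable [IsOrderedAddMonoid A]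

lemma antitone_apply_iterate_sub_apply_iterate_succ (hB : IsPositiveContraction p B) (f : E) :
    Antitone fun m => p f (B^[m] f) - p f (B^[m + 1] f) := by
  refine antitone_nat_of_succ_le fun m => sub_nonneg.1 ?_
  have second_difference : p (f - B f) (B^[m] (f - B f)) =
      p f (B^[m] f) - p f (B^[m + 1] f) - (p f (B^[m + 1] f) - p f (B^[m + 1 + 1] f)) := by
    simp only [iterate_map_sub, map_sub, AddMonoidHom.sub_apply, hB.symmetric,
      ← Function.iterate_succ_apply, ← Function.iterate_succ_apply' B, Nat.succ_eq_add_one]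
  exact second_difference ▸ hB.apply_iterate_nonneg (f - B f) m

lemma antitone_apply_iterate (hB : IsPositiveContraction p B) (f : E) :
    Antitone fun m => p f (B^[m] f) := by
  have even (j : ℕ) : 0 ≤ p f (B^[2 * j] f) - p f (B^[2 * j + 1] f) := by
    rw [sub_nonneg, two_mul, add_assoc, ← apply_iterate_iterate hB.symmetric f f j j,
      ← apply_iterate_iterate hB.symmetric, Function.iterate_succ_apply']
    exact hB.apply_le _
  refine antitone_nat_of_succ_le fun m => sub_nonneg.1 ?_
  exact (even m).trans (hB.antitone_apply_iterate_sub_apply_iterate_succ f (by omega))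

lemma apply_sub_iterate_self_le (hB : IsPositiveContraction p B) (f : E) (n : ℕ) :
    p (f - B^[n] f) (f - B^[n] f) ≤ p f f := by
  have expand : p (f - B^[n] f) (f - B^[n] f) =
      p f f - (p f (B^[n] f) - p f (B^[n + n] f)) - p f (B^[n] f) := by
    have left : p (B^[n] f) f = p f (B^[n] f) := apply_iterate_iterate hB.symmetric f f n 0
    simp only [map_sub, AddMonoidHom.sub_apply, left, apply_iterate_iterate hB.symmetric]
    abel
  have decrease : 0 ≤ p f (B^[n] f) - p f (B^[n + n] f) :=
    sub_nonneg.2 (hB.antitone_apply_iterate f (Nat.le_add_right n n))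
  rw [expand]
  exact (sub_le_self _ (hB.apply_iterate_nonneg f n)).trans (sub_le_self _ decrease)

lemma nsmul_apply_iterate_sub_apply_iterate_succ_le (hB : IsPositiveContraction p B) (f : E)
    (n : ℕ) : n • (p f (B^[n] f) - p f (B^[n + 1] f)) ≤ p f f := by
  calc n • (p f (B^[n] f) - p f (B^[n + 1] f))
      ≤ ∑ m ∈ Finset.range n, (p f (B^[m] f) - p f (B^[m + 1] f)) := by
        simpa using Finset.card_nsmul_le_sum (Finset.range n) _ _ fun m hm =>
          hB.antitone_apply_iterate_sub_apply_iterate_succ f (Finset.mem_range.1 hm).le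
    _ = p f f - p f (B^[n] f) := Finset.sum_range_sub' (fun m => p f (B^[m] f)) n
    _ ≤ p f f := sub_le_self _ (hB.apply_iterate_nonneg f n)

end IsPositiveContraction

end PositiveContraction

open Filter Topology

section CStarAlgebra

variable {A : Type*} [NonUnitalCStarAlgebra A] [PartialOrder A] [StarOrderedRing A]

lemma tendsto_zero_of_nsmul_le {a : ℕ → A} {b : A} (ha : ∀ n, 0 ≤ a n)
    (hab : ∀ n, n • a n ≤ b) : Tendsto a atTop (𝓝 0) := by
  refine squeeze_zero_norm' ?_ (tendsto_const_div_atTop_nhds_zero_nat ‖b‖)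
  filter_upwards [eventually_gt_atTop 0] with n hn
  rw [le_div_iff₀' (Nat.cast_pos.2 hn), ← nsmul_eq_mul, ← RCLike.norm_nsmul ℝ]
  exact CStarAlgebra.norm_le_norm_of_nonneg_of_le (nsmul_nonneg (ha n) n) (hab n)

lemma tendsto_zero_of_sum_star_mul_self {α ι : Type*} [Fintype ι] {l : Filter α}
    {a : α → ι → A} (ha : Tendsto (fun t => ∑ i, star (a t i) * a t i) l (𝓝 0)) :
    Tendsto a l (𝓝 0) := by
  refine tendsto_pi_nhds.2 fun i => squeeze_zero_norm (fun t => ?_) (by simpa using ha.norm.sqrt)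
  refine Real.le_sqrt_of_sq_le ?_
  rw [sq, ← CStarRing.norm_star_mul_self]
  exact CStarAlgebra.norm_le_norm_of_nonneg_of_le (star_mul_self_nonneg _)
    (Finset.single_le_sum (f := fun i => star (a t i) * a t i)
      (fun _ _ => star_mul_self_nonneg _) (Finset.mem_univ i))

lemma IsPositiveContraction.tendsto_apply_self_sub_apply_iterate {E : Type*} [AddCommGroup E]
    {p : E →+ E →+ A} {B : E →+ E} (hB : IsPositiveContraction p B) (f : E) :
    Tendsto (fun n => p (B^[n] f) (B^[n] f) - p (B^[n] f) (B (B^[n] f))) atTop (𝓝 0) := by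
  have differences : Tendsto (fun m => p f (B^[m] f) - p f (B^[m + 1] f)) atTop (𝓝 0) :=
    tendsto_zero_of_nsmul_le (fun m => sub_nonneg.2 (hB.antitone_apply_iterate f m.le_succ))
      (hB.nsmul_apply_iterate_sub_apply_iterate_succ_le f)
  simp only [← Function.iterate_succ_apply' B, apply_iterate_iterate hB.symmetric]
  exact differences.comp (tendsto_id.atTop_add_atTop tendsto_id)

end CStarAlgebra

namespace PDKernel

variable {X A : Type*} [NonUnitalCStarAlgebra A] [PartialOrder A] [StarOrderedRing A]

lemma star_inner (k : PDKernel X A) (f g : k.RKHM) : star (k.inner f g) = k.inner g f := by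
  have hc := k.continuous_inner
  induction f, g using UniformSpace.Completion.induction_on₂ with
  | hp => exact isClosed_eq hc.star (hc.comp continuous_swap)
  | ih f g => simp only [inner_coe, star_preInner]

lemma inner_add_right (k : PDKernel X A) (f g h : k.RKHM) :
    k.inner f (g + h) = k.inner f g + k.inner f h := by
  have hc := k.continuous_inner
  induction f, g, h using UniformSpace.Completion.induction_on₃ with
  | hp =>
    exact isClosed_eq
      (hc.comp (continuous_fst.prodMk (continuous_snd.fst.add continuous_snd.snd)))
      ((hc.comp (continuous_fst.prodMk continuous_snd.fst)).add
        (hc.comp (continuous_fst.prodMk continuous_snd.snd)))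
  | ih f g h => simp only [← UniformSpace.Completion.coe_add, inner_coe, preInner_add_right]

lemma inner_add_left (k : PDKernel X A) (f g h : k.RKHM) :
    k.inner (f + g) h = k.inner f h + k.inner g h := by
  rw [← star_inner, inner_add_right, star_add, star_inner, star_inner]

/-- The `A`-valued inner product of `M_k` as a biadditive map. -/
noncomputable def innerHom (k : PDKernel X A) : k.RKHM →+ k.RKHM →+ A :=
  AddMonoidHom.mk' (fun f => AddMonoidHom.mk' (k.inner f) (k.inner_add_right f))
    fun f g => AddMonoidHom.ext (k.inner_add_left f g)

@[simp]
lemma innerHom_apply (k : PDKernel X A) (f g : k.RKHM) : k.innerHom f g = k.inner f g := rfl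

lemma inner_self_nonneg (k : PDKernel X A) (f : k.RKHM) : 0 ≤ k.inner f f := by
  induction f using UniformSpace.Completion.induction_on with
  | hp =>
    exact CStarAlgebra.isClosed_nonneg.preimage
      (k.continuous_inner.comp (continuous_id.prodMk continuous_id))
  | ih f => simpa only [inner_coe] using preInner_self_nonneg f

lemma absVal_le_absVal {k : PDKernel X A} {f g : k.RKHM} (h : k.inner f f ≤ k.inner g g) :
    k.absVal f ≤ k.absVal g :=
  CFC.sqrt_le_sqrt _ _ h

lemma star_preEval_mul_preEval_le (k : PDKernel X A) (x : X) (f : k.Pre) :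
    star (k.preEval x f) * k.preEval x f ≤ ‖k.toFun x x‖ • k.preInner f f := by
  set a := k.preEval x f
  set K := ‖k.toFun x x‖
  rcases (norm_nonneg (k.toFun x x)).eq_or_lt' with hK | hK
  · have ha : a = 0 := norm_le_zero_iff.1 (by simpa [hK] using k.norm_preEval_le x f)
    simp [ha, hK, K]
  have kernel_le : star a * k.toFun x x * a ≤ K • (star a * a) :=
    CStarAlgebra.star_left_conjugate_le_norm_smul (hb := (k.star_symm x x).symm)
  have right : k.preInner f (k.preFeatureMul x (-a)) = -(star a * a) := by
    rw [← star_preInner, preInner_preFeatureMul]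
    simp [a]
  have expand : k.preInner ((K : ℂ) • f + k.preFeatureMul x (-a))
      ((K : ℂ) • f + k.preFeatureMul x (-a)) =
      K • (K • k.preInner f f) - K • (star a * a) -
        (K • (star a * a) - star a * k.toFun x x * a) := by
    simp only [preInner_add_left, preInner_add_right, preInner_smul_left, preInner_smul_right,
      right, preInner_preFeatureMul, preEval_preFeatureMul]
    simp only [RCLike.star_def, Complex.conj_ofReal, Complex.coe_smul, star_neg, neg_mul, mul_neg,
      neg_neg, smul_add, smul_neg, mul_assoc, a]
    abel
  have completed_square : 0 ≤ K • (K • k.preInner f f) - K • (star a * a) :=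
    (expand ▸ preInner_self_nonneg _).trans (sub_le_self _ (sub_nonneg.2 kernel_le))
  exact (smul_le_smul_iff_of_pos_left hK).1 (sub_nonneg.1 completed_square)

lemma star_eval_mul_eval_le (k : PDKernel X A) (x : X) (f : k.RKHM) :
    star (k.eval x f) * k.eval x f ≤ ‖k.toFun x x‖ • k.inner f f := by
  rw [← sub_nonneg]
  induction f using UniformSpace.Completion.induction_on with
  | hp =>
    have hc : Continuous fun f : k.RKHM => k.inner f f :=
      k.continuous_inner.comp (continuous_id.prodMk continuous_id)
    exact CStarAlgebra.isClosed_nonneg.preimage (by fun_prop)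
  | ih f =>
    rw [eval_coe, inner_coe, sub_nonneg]
    exact k.star_preEval_mul_preEval_le x f

lemma inner_featureMul_left (k : PDKernel X A) (x : X) (c : A) (f : k.RKHM) :
    k.inner (k.featureMul x c) f = star c * k.eval x f := by
  induction f using UniformSpace.Completion.induction_on with
  | hp =>
    exact isClosed_eq (k.continuous_inner.comp (continuous_const.prodMk continuous_id))
      (continuous_const.mul (k.eval x).continuous)
  | ih f => rw [featureMul, inner_coe, eval_coe, preInner_preFeatureMul]

lemma inner_featureMul_right (k : PDKernel X A) (x : X) (c : A) (f : k.RKHM) :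
    k.inner f (k.featureMul x c) = star (k.eval x f) * c := by
  rw [← star_inner, inner_featureMul_left, star_mul, star_star]

lemma featureMul_add (k : PDKernel X A) (x : X) (c d : A) :
    k.featureMul x (c + d) = k.featureMul x c + k.featureMul x d := by
  rw [featureMul, featureMul, featureMul, ← UniformSpace.Completion.coe_add]
  exact congrArg _ (pre_ext fun y => by simp [mul_add])

variable {ι : Type*} [Fintype ι]

lemma sum_star_eval_mul_eval_le (k : PDKernel X A) (x : ι → X) (f : k.RKHM) :
    ∑ i, star (k.eval (x i) f) * k.eval (x i) f ≤
      (∑ i, ‖k.toFun (x i) (x i)‖) • k.inner f f := by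
  rw [Finset.sum_smul]
  exact Finset.sum_le_sum fun i _ => k.star_eval_mul_eval_le (x i) f

/-- The synthesis map `c ↦ ∑ i, φ(x i) c i`, adjoint to the evaluation at the points `x i`. -/
noncomputable def synthesis (k : PDKernel X A) (x : ι → X) : (ι → A) →+ k.RKHM :=
  AddMonoidHom.mk' (fun c => ∑ i, k.featureMul (x i) (c i)) fun c d => by
    simp only [Pi.add_apply, featureMul_add, Finset.sum_add_distrib]

lemma inner_synthesis_right (k : PDKernel X A) (x : ι → X) (f : k.RKHM) (c : ι → A) :
    k.inner f (k.synthesis x c) = ∑ i, star (k.eval (x i) f) * c i := by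
  simp only [← innerHom_apply, synthesis, AddMonoidHom.mk'_apply, map_sum]
  simp only [innerHom_apply, inner_featureMul_right]

/-- The step `1 - τ T⋆T` of the Landweber iteration, where `T` evaluates at the points `x i`. -/
noncomputable def landweber (k : PDKernel X A) (x : ι → X) (τ : ℝ) : k.RKHM →+ k.RKHM :=
  AddMonoidHom.mk' (fun f => f - k.synthesis x fun i => τ • k.eval (x i) f) fun f g => by
    simp only [map_add, smul_add, ← Pi.add_def, add_sub_add_comm]

lemma sub_landweber_apply (k : PDKernel X A) (x : ι → X) (τ : ℝ) (f : k.RKHM) :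
    f - k.landweber x τ f = k.synthesis x fun i => τ • k.eval (x i) f :=
  sub_sub_cancel _ _

lemma inner_sub_inner_landweber (k : PDKernel X A) (x : ι → X) (τ : ℝ) (f g : k.RKHM) :
    k.inner f g - k.inner f (k.landweber x τ g) =
      τ • ∑ i, star (k.eval (x i) f) * k.eval (x i) g := by
  simp only [← innerHom_apply, ← map_sub, sub_landweber_apply]
  simp only [innerHom_apply, inner_synthesis_right, mul_smul_comm, Finset.smul_sum]

lemma inner_landweber_left (k : PDKernel X A) (x : ι → X) (τ : ℝ) (f g : k.RKHM) :
    k.inner (k.landweber x τ f) g = k.inner f (k.landweber x τ g) := by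
  have hfg := k.inner_sub_inner_landweber x τ f g
  have hgf := congrArg star (k.inner_sub_inner_landweber x τ g f)
  simp only [star_sub, star_inner, star_smul, star_sum, star_mul, star_star, star_trivial] at hgf
  exact sub_right_injective (hgf.trans hfg.symm)

lemma isPositiveContraction_landweber (k : PDKernel X A) (x : ι → X) {τ : ℝ} (hτ : 0 ≤ τ)
    (hτk : τ * ∑ i, ‖k.toFun (x i) (x i)‖ ≤ 1) :
    IsPositiveContraction k.innerHom (k.landweber x τ) where
  symmetric := k.inner_landweber_left x τ
  nonneg f := by
    rw [innerHom_apply, ← sub_sub_cancel (k.inner f f) (k.inner f _), inner_sub_inner_landweber,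
      sub_nonneg]
    calc τ • ∑ i, star (k.eval (x i) f) * k.eval (x i) f
        ≤ τ • ((∑ i, ‖k.toFun (x i) (x i)‖) • k.inner f f) :=
          smul_le_smul_of_nonneg_left (k.sum_star_eval_mul_eval_le x f) hτ
      _ = (τ * ∑ i, ‖k.toFun (x i) (x i)‖) • k.inner f f := smul_smul _ _ _
      _ ≤ k.inner f f := smul_le_of_le_one_left (k.inner_self_nonneg f) hτk
  apply_le f := by
    rw [innerHom_apply, innerHom_apply, ← sub_nonneg, inner_sub_inner_landweber]
    exact smul_nonneg hτ (Finset.sum_nonneg fun _ _ => star_mul_self_nonneg _)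

lemma exists_seq_synthesis_tendsto_eval (k : PDKernel X A) (x : ι → X) (f : k.RKHM) :
    ∃ c : ℕ → ι → A,
      (∀ n, k.inner (k.synthesis x (c n)) (k.synthesis x (c n)) ≤ k.inner f f) ∧
      Tendsto (fun n i => k.eval (x i) (k.synthesis x (c n))) atTop
        (𝓝 fun i => k.eval (x i) f) := by
  set K := 1 + ∑ i, ‖k.toFun (x i) (x i)‖
  have hK : 0 < K := by positivity
  set B := k.landweber x K⁻¹
  have hB : IsPositiveContraction k.innerHom B :=
    k.isPositiveContraction_landweber x (inv_nonneg.2 hK.le)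
      ((inv_mul_le_one₀ hK).2 (le_add_of_nonneg_left zero_le_one))
  have iterates_mem_range (n : ℕ) : f - B^[n] f ∈ (k.synthesis x).range :=
    sub_iterate_mem (fun g => AddMonoidHom.mem_range.2 ⟨_, (k.sub_landweber_apply x K⁻¹ g).symm⟩)
      f n
  choose c hc using iterates_mem_range
  refine ⟨c, fun n => hc n ▸ hB.apply_sub_iterate_self_le f n, ?_⟩
  have residual : Tendsto (fun n i => k.eval (x i) (B^[n] f)) atTop (𝓝 0) := by
    have energy := (hB.tendsto_apply_self_sub_apply_iterate f).const_smul K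
    simp only [innerHom_apply, B, inner_sub_inner_landweber, smul_inv_smul₀ hK.ne',
      smul_zero] at energy
    exact tendsto_zero_of_sum_star_mul_self energy
  simpa only [hc, map_sub, Pi.sub_def, Pi.zero_apply, sub_zero] using
    residual.const_sub (fun i => k.eval (x i) f)

lemma norm_loss_sub_loss_le (k : PDKernel X A) {N : ℕ} (x : Fin N → X)
    (g : (Fin N → A) → {a : A // 0 ≤ a}) {h : {a : A // 0 ≤ a} → {a : A // 0 ≤ a}}
    (hh : Monotone h) {f f₀ : k.RKHM} (hle : k.inner f f ≤ k.inner f₀ f₀)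
    (hloss : k.loss x g h f₀ ≤ k.loss x g h f) :
    ‖k.loss x g h f - k.loss x g h f₀‖ ≤
      ‖(g fun i => k.eval (x i) f : A) - g fun i => k.eval (x i) f₀‖ := by
  refine CStarAlgebra.norm_le_norm_of_nonneg_of_le (sub_nonneg.2 hloss) ?_
  have hreg : (h (k.absVal f) : A) ≤ h (k.absVal f₀) := hh (absVal_le_absVal hle)
  rw [loss, loss, add_sub_add_comm]
  exact add_le_of_nonpos_right (sub_nonpos.2 hreg)

end PDKernel

theorem mainTheorem5 {X A : Type*} [NonUnitalCStarAlgebra A] [PartialOrder A] [StarOrderedRing A]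
    (k : PDKernel X A) {N : ℕ} (x : Fin N → X)
    (g : (Fin N → A) → {a : A // 0 ≤ a}) (hg : Continuous g)
    (h : {a : A // 0 ≤ a} → {a : A // 0 ≤ a}) (hh : ∀ c d, c ≤ d → h c ≤ h d)
    (f₀ : k.RKHM) (hf₀ : ∀ f : k.RKHM, k.loss x g h f₀ ≤ k.loss x g h f)
    (ε : ℝ) (hε : 0 < ε) :
    ∃ c : Fin N → A,
      ‖k.loss x g h (∑ i, k.featureMul (x i) (c i)) - k.loss x g h f₀‖ ≤ ε := by
  obtain ⟨c, hle, hlim⟩ := k.exists_seq_synthesis_tendsto_eval x f₀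
  have data_term : Tendsto (fun n => (g fun i => k.eval (x i) (k.synthesis x (c n)) : A)) atTop
      (𝓝 (g fun i => k.eval (x i) f₀)) :=
    ((continuous_subtype_val.comp hg).tendsto _).comp hlim
  obtain ⟨n, hn⟩ := (data_term.eventually (Metric.closedBall_mem_nhds _ hε)).exists
  exact ⟨c n, (k.norm_loss_sub_loss_le x g hh (hle n) (hf₀ _)).trans
    (mem_closedBall_iff_norm.1 hn)⟩
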